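/- For an integer $n\ge 2$ let $P^+(n)$ denote the largest prime divisor of $n$. The set of integers $n\ge 2$ such that $P^+(n)>\sqrt{n}$ and $\gcd(P^+(n)-1,\,n)=1$ has natural density $$(\log 2)\prod_{p}\left(1-\frac{1}{p(p-1)}\right),$$ where the (convergent) product runs over all prime numbers $p$. That is, the number of such $n\le N$, divided by $N$, tends to this value as $N\to\infty$. -/

import Mathlib

/-- A set `S` of natural numbers has natural density `δ` if the proportion of elements of `S`
among the positive integers `1, …, N` tends to `δ` as `N → ∞`. -/
def HasNaturalDensity (S : Set ℕ) (δ : ℝ) : Prop :=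
  Filter.Tendsto (fun N : ℕ => ((S ∩ Set.Icc 1 N).ncard : ℝ) / (N : ℝ)) Filter.atTop (nhds δ)

/-- `p` is the largest prime divisor of `n`. (No `p` satisfies this if `n = 0` or `n = 1`.) -/
def IsLargestPrimeFactor (p n : ℕ) : Prop :=
  IsGreatest {q : ℕ | q.Prime ∧ q ∣ n} p

/-! ### Equidistribution from moments (Karamata's method) -/

section Karamata

open Filter Topology MeasureTheory

variable {ι : Type*} {l : Filter ι} {v t : ι → ℕ → ℝ} {c : ℝ}

/-! If `P⁺(n) > √n`, then `n = p m` with `p` prime and `m < p`, and `p` is determined by `n`. Since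
`p - 1` is coprime to `p`, the gcd condition says that `p - 1` and `m` are coprime. Up to `o(N)`
integers, the count is therefore that of pairs with `√N < p ≤ N`, `m ≤ N / p` and `gcd(p - 1, m) =
1` (`pairCount`).

Forbid only common primes up to a fixed `z` (`truncatedPairCount`). Möbius inversion gives a finite
sum over `d ∣ primorial z` of `μ(d)` times roughly `(N / d) ∑ 1 / p`, over primes `p ≡ 1 mod d` in
`(√N, N]`. The inner sum tends to `log 2 / φ(d)`, and `∑ μ(d) / (d φ(d))` is the Euler product up to
`z`.

Two facts about primes carry this. The limit `log 2 / φ(d)` (`tendsto_sum_inv_primes`) uses no prime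
number theorem in progressions: the simple pole at `s = 1` of the Dirichlet series of `Λ` on a
residue class, approached along the real axis, feeds a Karamata argument. To let `z → ∞` uniformly
in `N`, `sum_inv_primes_le` bounds the sum for a prime modulus `q` by `O(log (q + 1) / q)`, by a
Chebyshev-style divisibility argument. Omitting the primes `q > z` thus costs at most a constant
times `N ∑ log (q + 1) / q²`, the tail of a convergent series. -/

theorem summable_mul_of_mem_Icc (hv : ∀ i n, 0 ≤ v i n) (hs : ∀ i, Summable (v i))
    (ht : ∀ i n, t i n ∈ Set.Icc (0 : ℝ) 1) {h : ℝ → ℝ} {M : ℝ}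
    (hM : ∀ x ∈ Set.Icc (0 : ℝ) 1, |h x| ≤ M) (i : ι) :
    Summable fun n => v i n * h (t i n) := by
  refine Summable.of_norm_bounded ((hs i).mul_right M) fun n => ?_
  rw [norm_mul, Real.norm_of_nonneg (hv i n)]
  exact mul_le_mul_of_nonneg_left (hM _ (ht i n)) (hv i n)

theorem exists_abs_le_of_continuous {h : ℝ → ℝ} (hh : Continuous h) :
    ∃ M, ∀ x ∈ Set.Icc (0 : ℝ) 1, |h x| ≤ M :=
  isCompact_Icc.exists_bound_of_continuousOn hh.continuousOn

theorem tendsto_tsum_mul_polynomial (hv : ∀ i n, 0 ≤ v i n) (hs : ∀ i, Summable (v i))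
    (ht : ∀ i n, t i n ∈ Set.Icc (0 : ℝ) 1)
    (hm : ∀ k : ℕ, Tendsto (fun i => ∑' n, v i n * t i n ^ k) l (𝓝 (c / (k + 1))))
    (p : Polynomial ℝ) :
    Tendsto (fun i => ∑' n, v i n * p.eval (t i n)) l (𝓝 (c * ∫ x in (0 : ℝ)..1, p.eval x)) := by
  have hsum : ∀ (p : Polynomial ℝ) i, Summable fun n => v i n * p.eval (t i n) := fun p i => by
    obtain ⟨M, hM⟩ := exists_abs_le_of_continuous p.continuous
    exact summable_mul_of_mem_Icc hv hs ht hM i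
  induction p using Polynomial.induction_on' with
  | add p q hp hq =>
    simp only [Polynomial.eval_add]
    rw [intervalIntegral.integral_add (p.continuous.intervalIntegrable _ _)
      (q.continuous.intervalIntegrable _ _), mul_add]
    refine (hp.add hq).congr fun i => ?_
    rw [← (hsum p i).tsum_add (hsum q i)]
    exact tsum_congr fun n => by ring
  | monomial k a =>
    simp only [Polynomial.eval_monomial]
    rw [intervalIntegral.integral_const_mul, integral_pow]
    have := (hm k).const_mul a
    convert this using 2
    · rw [← tsum_mul_left]
      exact tsum_congr fun n => by ring
    · simp
      ring

/-- Weierstrass approximation extends the limit from polynomials; the error is controlled because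
the zeroth moment keeps the total mass bounded. -/
theorem tendsto_tsum_mul_continuous (hv : ∀ i n, 0 ≤ v i n) (hs : ∀ i, Summable (v i))
    (ht : ∀ i n, t i n ∈ Set.Icc (0 : ℝ) 1)
    (hm : ∀ k : ℕ, Tendsto (fun i => ∑' n, v i n * t i n ^ k) l (𝓝 (c / (k + 1))))
    {h : ℝ → ℝ} (hh : Continuous h) :
    Tendsto (fun i => ∑' n, v i n * h (t i n)) l (𝓝 (c * ∫ x in (0 : ℝ)..1, h x)) := by
  rw [Metric.tendsto_nhds]
  intro ε hε
  have hmass : Tendsto (fun i => ∑' n, v i n) l (𝓝 c) := by simpa using hm 0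
  -- Approximating `h` within `δ` costs `(|c| + 1) δ` in the sum and `|c| δ` in the integral,
  -- together below `ε / 2`.
  set δ := ε / (2 * (2 * |c| + 2)) with hδ
  have hc := abs_nonneg c
  have hδ0 : 0 < δ := by positivity
  have hδe : δ * (2 * |c| + 2) = ε / 2 := by rw [hδ]; field_simp
  obtain ⟨p, hp⟩ := exists_polynomial_near_of_continuousOn 0 1 h hh.continuousOn δ hδ0
  have hpt := tendsto_tsum_mul_polynomial hv hs ht hm p
  filter_upwards [(Metric.tendsto_nhds.mp hpt) (ε / 2) (by positivity),
    hmass.eventually (gt_mem_nhds (show c < |c| + 1 by linarith [le_abs_self c]))] with i h1 h2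
  rw [Real.dist_eq] at h1 ⊢
  obtain ⟨M, hM⟩ := exists_abs_le_of_continuous hh
  obtain ⟨M', hM'⟩ := exists_abs_le_of_continuous p.continuous
  have hsh := summable_mul_of_mem_Icc hv hs ht hM i
  have hsp := summable_mul_of_mem_Icc hv hs ht hM' i
  have e1 : |(∑' n, v i n * h (t i n)) - ∑' n, v i n * p.eval (t i n)| ≤ (∑' n, v i n) * δ := by
    rw [← hsh.tsum_sub hsp, ← tsum_mul_right]
    refine tsum_of_norm_bounded (f := fun n => v i n * h (t i n) - v i n * p.eval (t i n))
      ((hs i).mul_right δ).hasSum fun n => ?_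
    rw [← mul_sub, norm_mul, Real.norm_of_nonneg (hv i n), Real.norm_eq_abs, abs_sub_comm]
    exact mul_le_mul_of_nonneg_left (hp _ (ht i n)).le (hv i n)
  have e2 : |(∫ x in (0 : ℝ)..1, p.eval x) - ∫ x in (0 : ℝ)..1, h x| ≤ δ := by
    rw [← intervalIntegral.integral_sub (p.continuous.intervalIntegrable _ _)
      (hh.intervalIntegrable _ _)]
    have := intervalIntegral.norm_integral_le_of_norm_le_const (a := 0) (b := 1) (C := δ)
      (f := fun x => p.eval x - h x) fun x hx => by
        rw [Set.uIoc_of_le zero_le_one] at hx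
        exact (hp x ⟨hx.1.le, hx.2⟩).le
    simpa using this
  have e3 : |c * (∫ x in (0 : ℝ)..1, p.eval x) - c * ∫ x in (0 : ℝ)..1, h x| ≤ |c| * δ := by
    rw [← mul_sub, abs_mul]
    exact mul_le_mul_of_nonneg_left e2 hc
  have e4 : (∑' n, v i n) * δ ≤ (|c| + 1) * δ := mul_le_mul_of_nonneg_right h2.le hδ0.le
  rw [abs_lt] at h1 ⊢
  rw [abs_le] at e1 e3
  constructor <;> nlinarith

/-- Thickened indicators of a closed set converge pointwise to its indicator, and dominated
convergence passes this to the integrals. -/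
theorem exists_continuous_ge_indicator {g : ℝ → ℝ} (hg : Continuous g) (hg0 : ∀ x, 0 ≤ g x)
    {F : Set ℝ} (hF : IsClosed F) {ε : ℝ} (hε : 0 < ε) :
    ∃ h : ℝ → ℝ, Continuous h ∧ (∀ x, F.indicator g x ≤ h x) ∧ (∀ x, h x ≤ g x) ∧
      ∫ x in (0 : ℝ)..1, h x < (∫ x in (0 : ℝ)..1, F.indicator g x) + ε := by
  have hpos : ∀ n : ℕ, (0 : ℝ) < 1 / (n + 1) := fun n => Nat.one_div_pos_of_nat
  let H : ℕ → ℝ → ℝ := fun n x => g x * thickenedIndicator (hpos n) F x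
  have hH : ∀ n, Continuous (H n) := fun n =>
    hg.mul (NNReal.continuous_coe.comp (thickenedIndicator (hpos n) F).continuous)
  have hle : ∀ n x, H n x ≤ g x := fun n x => by
    refine mul_le_of_le_one_right (hg0 x) ?_
    exact_mod_cast thickenedIndicator_le_one (hpos n) F x
  have hlim : Tendsto (fun n => ∫ x in (0 : ℝ)..1, H n x) atTop
      (𝓝 (∫ x in (0 : ℝ)..1, F.indicator g x)) := by
    refine intervalIntegral.tendsto_integral_filter_of_dominated_convergence g
      (Eventually.of_forall fun n => (hH n).aestronglyMeasurable)
      (Eventually.of_forall fun n => ae_of_all _ fun x _ => ?_) (hg.intervalIntegrable _ _)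
      (ae_of_all _ fun x _ => ?_)
    · rw [Real.norm_of_nonneg (mul_nonneg (hg0 x) NNReal.zero_le_coe)]
      exact hle n x
    · have := thickenedIndicator_tendsto_indicator_closure hpos
        tendsto_one_div_add_atTop_nhds_zero_nat F
      rw [tendsto_pi_nhds, hF.closure_eq] at this
      have h2 := ((NNReal.continuous_coe.tendsto _).comp (this x)).const_mul (g x)
      have h3 : F.indicator g x = g x * ((F.indicator (fun _ => (1 : NNReal)) x : NNReal) : ℝ) := by
        by_cases hx : x ∈ F <;> simp [hx]
      rw [h3]
      exact h2
  obtain ⟨n, hn⟩ := (hlim.eventually (gt_mem_nhds (lt_add_of_pos_right _ hε))).exists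
  refine ⟨H n, hH n, fun x => ?_, hle n, hn⟩
  by_cases hx : x ∈ F
  · have := thickenedIndicator_one (hpos n) F hx
    simp only [hx, Set.indicator_of_mem, H, this]
    simp
  · simp only [hx, not_false_eq_true, Set.indicator_of_notMem]
    exact mul_nonneg (hg0 x) NNReal.zero_le_coe

theorem tendsto_tsum_mul_indicator (hv : ∀ i n, 0 ≤ v i n) (hs : ∀ i, Summable (v i))
    (ht : ∀ i n, t i n ∈ Set.Icc (0 : ℝ) 1)
    (hm : ∀ k : ℕ, Tendsto (fun i => ∑' n, v i n * t i n ^ k) l (𝓝 (c / (k + 1))))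
    (hc : 0 ≤ c) {g : ℝ → ℝ} (hg : Continuous g) (hg0 : ∀ x, 0 ≤ g x) {a b : ℝ} (ha : 0 ≤ a)
    (hab : a ≤ b) (hb : b ≤ 1) :
    Tendsto (fun i => ∑' n, v i n * (Set.Ico a b).indicator g (t i n)) l
      (𝓝 (c * ∫ x in a..b, g x)) := by
  obtain ⟨M, hM⟩ := exists_abs_le_of_continuous hg
  have hint : ∀ s : Set ℝ, MeasurableSet s → s ⊆ Set.Icc a b → Set.Ioo a b ⊆ s →
      ∫ x in (0 : ℝ)..1, s.indicator g x = ∫ x in a..b, g x := fun s hs h1 h2 => by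
    rw [intervalIntegral.integral_of_le zero_le_one, intervalIntegral.integral_of_le hab,
      ← integral_Icc_eq_integral_Ioc, ← integral_Icc_eq_integral_Ioc,
      setIntegral_indicator hs, Set.inter_eq_self_of_subset_right
        (h1.trans (Set.Icc_subset_Icc ha hb))]
    refine setIntegral_congr_set ?_
    refine (LE.le.eventuallyLE h1).antisymm ?_
    exact (Ioo_ae_eq_Icc.symm.le).trans (LE.le.eventuallyLE h2)
  have hsI : ∀ i, Summable fun n => v i n * (Set.Ico a b).indicator g (t i n) := fun i =>
    summable_mul_of_mem_Icc hv hs ht (M := M) (fun x hx => by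
      by_cases h : x ∈ Set.Ico a b
      · simpa [h] using hM x hx
      · simpa [h] using (abs_nonneg _).trans (hM x hx)) i
  have hsc : ∀ {h : ℝ → ℝ}, Continuous h → ∀ i, Summable fun n => v i n * h (t i n) :=
    fun hh i => by
      obtain ⟨M, hM⟩ := exists_abs_le_of_continuous hh
      exact summable_mul_of_mem_Icc hv hs ht hM i
  -- Sandwich: the majorant comes from the closed interval, the minorant is `g` minus a majorant on
  -- the complement of the open interval. Endpoints have measure zero.
  have key : ∀ ε > 0, (∃ h : ℝ → ℝ, Continuous h ∧ (∀ x, (Set.Ico a b).indicator g x ≤ h x) ∧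
      ∫ x in (0 : ℝ)..1, h x < (∫ x in a..b, g x) + ε) ∧
      ∃ h : ℝ → ℝ, Continuous h ∧ (∀ x, h x ≤ (Set.Ico a b).indicator g x) ∧
      (∫ x in a..b, g x) - ε < ∫ x in (0 : ℝ)..1, h x := by
    intro ε hε
    constructor
    · obtain ⟨h, h1, h2, -, h4⟩ := exists_continuous_ge_indicator hg hg0
        (isClosed_Icc (a := a) (b := b)) hε
      refine ⟨h, h1, fun x => (Set.indicator_le_indicator_of_subset Set.Ico_subset_Icc_self
        (fun x => hg0 x) x).trans (h2 x), ?_⟩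
      rwa [hint _ measurableSet_Icc le_rfl Set.Ioo_subset_Icc_self] at h4
    · obtain ⟨h, h1, h2, h3, h4⟩ := exists_continuous_ge_indicator hg hg0
        (isOpen_Ioo (a := a) (b := b)).isClosed_compl hε
      refine ⟨fun x => g x - h x, hg.sub h1, fun x => ?_, ?_⟩
      · by_cases hx : x ∈ Set.Ioo a b
        · have hx' : x ∈ Set.Ico a b := ⟨hx.1.le, hx.2⟩
          have := h2 x
          simp only [Set.mem_compl_iff, hx, not_true_eq_false, not_false_eq_true,
            Set.indicator_of_notMem] at this
          simp [hx', this]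
        · have := h2 x
          simp only [Set.mem_compl_iff, hx, not_false_eq_true, Set.indicator_of_mem] at this
          exact (sub_nonpos.mpr this).trans (Set.indicator_nonneg (fun x _ => hg0 x) x)
      · rw [intervalIntegral.integral_sub (hg.intervalIntegrable _ _)
          (h1.intervalIntegrable _ _)]
        have e : ∫ x in (0 : ℝ)..1, (Set.Ioo a b)ᶜ.indicator g x =
            (∫ x in (0 : ℝ)..1, g x) - ∫ x in a..b, g x := by
          rw [← hint _ measurableSet_Ioo Set.Ioo_subset_Icc_self le_rfl,
            ← intervalIntegral.integral_sub (hg.intervalIntegrable _ _)]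
          · refine intervalIntegral.integral_congr fun x _ => ?_
            simp only [Set.indicator_compl, Pi.sub_apply]
          · rw [intervalIntegrable_iff]
            exact ((hg.intervalIntegrable 0 1).def').indicator measurableSet_Ioo
        linarith
  rw [Metric.tendsto_nhds]
  intro ε hε
  have hc1 : (0 : ℝ) < c + 1 := by linarith
  obtain ⟨⟨h, h1, h2, h3⟩, ⟨k, k1, k2, k3⟩⟩ := key (ε / (2 * (c + 1))) (by positivity)
  have hce : c * (ε / (2 * (c + 1))) ≤ ε / 2 := by
    rw [← mul_div_assoc, div_le_div_iff₀ (by positivity) (by positivity)]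
    nlinarith
  filter_upwards [Metric.tendsto_nhds.mp (tendsto_tsum_mul_continuous hv hs ht hm h1) (ε / 2)
    (by positivity), Metric.tendsto_nhds.mp (tendsto_tsum_mul_continuous hv hs ht hm k1) (ε / 2)
    (by positivity)] with i hi ki
  rw [Real.dist_eq, abs_lt] at *
  have l1 := (hsI i).tsum_le_tsum (fun n => mul_le_mul_of_nonneg_left (h2 (t i n)) (hv i n))
    (hsc h1 i)
  have l2 := (hsc k1 i).tsum_le_tsum (fun n => mul_le_mul_of_nonneg_left (k2 (t i n)) (hv i n))
    (hsI i)
  have m1 := mul_le_mul_of_nonneg_left h3.le hc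
  have m2 := mul_le_mul_of_nonneg_left k3.le hc
  rw [mul_add] at m1
  rw [mul_sub] at m2
  constructor <;> linarith [hi.1, hi.2, ki.1, ki.2]

end Karamata

/-! ### Reciprocals of primes in progressions between `√N` and `N` -/

section ReciprocalSums

open Filter Topology MeasureTheory ArithmeticFunction ArithmeticFunction.vonMangoldt

variable {d : ℕ} [NeZero d]

theorem tsum_residueClass_eq {a : ZMod d} (ha : IsUnit a) {x : ℝ} (hx : 1 < x) :
    ∑' n, residueClass a n / (n : ℝ) ^ x =
      (LFunctionResidueClassAux a x).re + (d.totient : ℝ)⁻¹ / (x - 1) := by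
  refine Complex.ofReal_injective ?_
  simp only [Complex.ofReal_tsum, Complex.ofReal_div, Complex.ofReal_cpow (Nat.cast_nonneg _),
    Complex.ofReal_natCast, Complex.ofReal_add, Complex.ofReal_inv, Complex.ofReal_sub,
    Complex.ofReal_one]
  simp_rw [← LFunctionResidueClassAux_real ha hx,
    eqOn_LFunctionResidueClassAux ha <| Set.mem_ofPred.mpr (Complex.ofReal_re x ▸ hx),
    sub_add_cancel, LSeries, LSeries.term]
  refine tsum_congr fun n ↦ ?_
  split_ifs with hn
  · simp only [hn, residueClass_apply_zero, Complex.ofReal_zero, zero_div]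
  · rfl

/-- After subtraction of the pole, the series has a continuous extension to `x = 1`, so only the
residue survives. -/
theorem tendsto_sub_one_mul_tsum_residueClass {a : ZMod d} (ha : IsUnit a) :
    Tendsto (fun x : ℝ => (x - 1) * ∑' n, residueClass a n / (n : ℝ) ^ x) (𝓝[>] 1)
      (𝓝 (d.totient : ℝ)⁻¹) := by
  have hcont : ContinuousOn (fun x : ℝ ↦ (LFunctionResidueClassAux a x).re) (Set.Ici 1) :=
    Complex.continuous_re.continuousOn.comp (t := Set.univ)
      (continuousOn_LFunctionResidueClassAux a) (fun ⦃x⦄ a ↦ trivial) |>.comp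
      Complex.continuous_ofReal.continuousOn fun x hx ↦ by
        simpa only [Set.mem_ofPred_eq, Complex.ofReal_re, Set.mem_Ici] using hx
  have h1 : Tendsto (fun x : ℝ ↦ (LFunctionResidueClassAux a x).re) (𝓝[>] 1)
      (𝓝 (LFunctionResidueClassAux a (1 : ℝ)).re) :=
    (hcont 1 (Set.mem_Ici.mpr le_rfl)).mono_left (nhdsWithin_mono _ Set.Ioi_subset_Ici_self)
  have h2 : Tendsto (fun x : ℝ => x - 1) (𝓝[>] 1) (𝓝 0) := by
    have : Tendsto (fun x : ℝ => x - 1) (𝓝 1) (𝓝 (1 - 1)) := by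
      exact (continuous_id.sub continuous_const).tendsto 1
    rw [sub_self] at this
    exact this.mono_left nhdsWithin_le_nhds
  have h3 := (h2.mul h1).add_const ((d.totient : ℝ)⁻¹)
  rw [zero_mul, zero_add] at h3
  refine h3.congr' ?_
  filter_upwards [self_mem_nhdsWithin] with x hx
  have hx' : x - 1 ≠ 0 := sub_ne_zero.mpr (Set.mem_Ioi.mp hx).ne'
  rw [tsum_residueClass_eq ha hx]
  field_simp

/-- The point `n ^ (-1 / log N)` attached to `n` at scale `N`. -/
noncomputable def scalePoint (N n : ℕ) : ℝ := Real.exp (-(Real.log n / Real.log N))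

/-- The weight `a n / (n log N) * n ^ (-1 / log N)` attached to `n` at scale `N`. -/
noncomputable def scaleWeight (a : ℕ → ℝ) (N n : ℕ) : ℝ :=
  a n / (n * Real.log N) * scalePoint N n

theorem scalePoint_mem (N n : ℕ) : scalePoint N n ∈ Set.Icc (0 : ℝ) 1 := by
  refine ⟨(Real.exp_pos _).le, Real.exp_le_one_iff.mpr ?_⟩
  exact neg_nonpos.mpr (div_nonneg (Real.log_natCast_nonneg _) (Real.log_natCast_nonneg _))

/-- The moments are values of the Dirichlet series at `1 + (k + 1) / log N`. The extra factor
`scalePoint` in the weight keeps this above `1` even for `k = 0`, and it yields the Lebesgue moments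
`1 / (k + 1)` in the limit. -/
theorem scaleWeight_mul_pow {a : ℕ → ℝ} (ha : a 0 = 0) (N n k : ℕ) :
    scaleWeight a N n * scalePoint N n ^ k =
      (Real.log N)⁻¹ * (a n / (n : ℝ) ^ (1 + (k + 1) / Real.log N)) := by
  rcases Nat.eq_zero_or_pos n with rfl | hn
  · simp [scaleWeight, ha]
  have hn' : (0 : ℝ) < n := by exact_mod_cast hn
  rw [scaleWeight, mul_assoc, ← pow_succ', scalePoint, ← Real.exp_nat_mul,
    Real.rpow_add hn', Real.rpow_one, Real.rpow_def_of_pos hn',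
    show ((k + 1 : ℕ) : ℝ) * -(Real.log n / Real.log N) =
      -(Real.log n * ((k + 1) / Real.log N)) by push_cast; ring, Real.exp_neg]
  simp only [div_eq_mul_inv, mul_inv]
  ring

theorem summable_scaleWeight_residueClass {d : ℕ} (a : ZMod d) (N : ℕ) :
    Summable (scaleWeight (residueClass a) N) := by
  have h : ∀ n, scaleWeight (residueClass a) N n = (Real.log N)⁻¹ *
      (residueClass a n / (n : ℝ) ^ (1 + 1 / Real.log N)) := fun n => by
    simpa using scaleWeight_mul_pow (residueClass_apply_zero a) N n 0
  rw [funext h]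
  rcases (Real.log_natCast_nonneg N).eq_or_lt with h0 | h0
  -- When `log N = 0`, the factor `0⁻¹ = 0` kills every term.
  · simp [← h0]
  refine Summable.mul_left _ ?_
  refine LSeries.summable_real_of_abscissaOfAbsConv_lt
    ((abscissaOfAbsConv_residueClass_le_one a).trans_lt ?_)
  have : (1 : ℝ) < 1 + 1 / Real.log N := by
    have : 0 < 1 / Real.log N := by positivity
    linarith
  exact_mod_cast this

theorem tendsto_moments_residueClass {a : ZMod d} (ha : IsUnit a) (k : ℕ) :
    Tendsto (fun N : ℕ => ∑' n, scaleWeight (residueClass a) N n * scalePoint N n ^ k) atTop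
      (𝓝 ((d.totient : ℝ)⁻¹ / (k + 1))) := by
  have hlog : Tendsto (fun N : ℕ => Real.log N) atTop atTop :=
    Real.tendsto_log_atTop.comp tendsto_natCast_atTop_atTop
  have h1 : Tendsto (fun N : ℕ => 1 + ((k : ℝ) + 1) / Real.log N) atTop (𝓝[>] 1) := by
    refine tendsto_nhdsWithin_iff.mpr ⟨?_, ?_⟩
    · simpa using (tendsto_const_nhds (x := (1 : ℝ))).add
        ((tendsto_const_nhds (x := ((k : ℝ) + 1))).div_atTop hlog)
    · filter_upwards [hlog.eventually_gt_atTop 0] with N hN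
      have : 0 < ((k : ℝ) + 1) / Real.log N := by positivity
      exact Set.mem_Ioi.mpr (by linarith)
  have h2 := ((tendsto_sub_one_mul_tsum_residueClass ha).comp h1).div_const ((k : ℝ) + 1)
  refine h2.congr fun N => ?_
  simp_rw [scaleWeight_mul_pow (residueClass_apply_zero a) N _ k]
  rw [tsum_mul_left]
  have : (k : ℝ) + 1 ≠ 0 := by positivity
  simp only [Function.comp_apply, add_sub_cancel_left]
  field_simp

/-- A continuous extension of `x ↦ 1 / (x * (-log x))` from `[e⁻¹, e^{-1/2}]`. -/
noncomputable def invMulLog (x : ℝ) : ℝ :=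
  1 / (max (Real.exp (-1)) (min (Real.exp (-(1 / 2))) x) *
    -Real.log (max (Real.exp (-1)) (min (Real.exp (-(1 / 2))) x)))

theorem exp_neg_one_le : Real.exp (-1) ≤ Real.exp (-(1 / 2)) := Real.exp_le_exp.mpr (by norm_num)

theorem invMulLog_aux (x : ℝ) : 0 < max (Real.exp (-1)) (min (Real.exp (-(1 / 2))) x) ∧
    0 < -Real.log (max (Real.exp (-1)) (min (Real.exp (-(1 / 2))) x)) := by
  have h : 0 < max (Real.exp (-1)) (min (Real.exp (-(1 / 2))) x) :=
    lt_max_of_lt_left (Real.exp_pos _)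
  refine ⟨h, ?_⟩
  have h2 : max (Real.exp (-1)) (min (Real.exp (-(1 / 2))) x) ≤ Real.exp (-(1 / 2)) :=
    max_le exp_neg_one_le (min_le_left _ _)
  have h3 := Real.log_le_log h h2
  rw [Real.log_exp] at h3
  linarith

theorem continuous_invMulLog : Continuous invMulLog := by
  unfold invMulLog
  have hc : Continuous fun x : ℝ => max (Real.exp (-1)) (min (Real.exp (-(1 / 2))) x) := by
    fun_prop
  refine continuous_const.div (hc.mul (hc.log fun x => (invMulLog_aux x).1.ne').neg) fun x => ?_
  exact (mul_pos (invMulLog_aux x).1 (invMulLog_aux x).2).ne'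

theorem invMulLog_nonneg (x : ℝ) : 0 ≤ invMulLog x :=
  one_div_nonneg.mpr (mul_pos (invMulLog_aux x).1 (invMulLog_aux x).2).le

theorem invMulLog_of_mem {x : ℝ} (hx : x ∈ Set.Icc (Real.exp (-1)) (Real.exp (-(1 / 2)))) :
    invMulLog x = 1 / (x * -Real.log x) := by
  rw [invMulLog, min_eq_right hx.2, max_eq_right hx.1]

theorem integral_invMulLog :
    ∫ x in Real.exp (-1)..Real.exp (-(1 / 2)), invMulLog x = Real.log 2 := by
  have h : ∀ x ∈ Set.uIcc (Real.exp (-1)) (Real.exp (-(1 / 2))),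
      HasDerivAt (fun y => -Real.log (-Real.log y)) (invMulLog x) x := by
    intro x hx
    rw [Set.uIcc_of_le exp_neg_one_le] at hx
    have hx0 : 0 < x := (Real.exp_pos _).trans_le hx.1
    have hl : Real.log x ≤ -(1 / 2) := by
      have := Real.log_le_log hx0 hx.2
      rwa [Real.log_exp] at this
    rw [invMulLog_of_mem hx]
    refine HasDerivAt.congr_deriv (((Real.hasDerivAt_log hx0.ne').neg).log
      (show -Real.log x ≠ 0 by linarith)).neg ?_
    rw [Pi.neg_apply, one_div, mul_inv, div_eq_mul_inv, neg_mul, neg_neg]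
  rw [intervalIntegral.integral_eq_sub_of_hasDerivAt h
    (continuous_invMulLog.intervalIntegrable _ _)]
  simp only [Real.log_exp, neg_neg, Real.log_one, neg_zero, sub_zero, one_div, Real.log_inv]

/-- The point decreases in `n`, with value `e⁻¹` at `n = N` and `e^{-1/2}` at `n = √N`. This is why
the interval is closed on the left and open on the right. -/
theorem scalePoint_mem_Ico_iff {N n : ℕ} (hN : 2 ≤ N) (hn : 0 < n) :
    scalePoint N n ∈ Set.Ico (Real.exp (-1)) (Real.exp (-(1 / 2))) ↔
      n ∈ Finset.Ioc N.sqrt N := by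
  have hL : 0 < Real.log N := Real.log_pos (by exact_mod_cast hN)
  have hn' : (0 : ℝ) < n := by exact_mod_cast hn
  have hN' : (0 : ℝ) < N := by exact_mod_cast (by omega : 0 < N)
  rw [scalePoint, Set.mem_Ico, Real.exp_le_exp, Real.exp_lt_exp, Finset.mem_Ioc, neg_le_neg_iff,
    neg_lt_neg_iff, div_le_one hL, lt_div_iff₀ hL, Real.log_le_log_iff hn' hN', Nat.cast_le,
    and_comm, Nat.sqrt_lt]
  refine and_congr_left fun _ => ?_
  have : 1 / 2 * Real.log N < Real.log n ↔ Real.log N < Real.log (n * n) := by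
    rw [Real.log_mul hn'.ne' hn'.ne']
    constructor <;> intro h <;> linarith
  rw [this, Real.log_lt_log_iff hN' (by positivity)]
  exact_mod_cast Iff.rfl

/-- With `x = scalePoint N n`, one has `-log x = log n / log N`, so the test function `1 / (x (-log
x))` cancels the damping factor and trades `log N` for `log n`. -/
theorem tsum_scaleWeight_mul_indicator {a : ℕ → ℝ} (ha : a 0 = 0) {N : ℕ} (hN : 2 ≤ N) :
    ∑' n, scaleWeight a N n *
      (Set.Ico (Real.exp (-1)) (Real.exp (-(1 / 2)))).indicator invMulLog (scalePoint N n) =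
      ∑ n ∈ Finset.Ioc N.sqrt N, a n / (n * Real.log n) := by
  have hL : 0 < Real.log N := Real.log_pos (by exact_mod_cast hN)
  have hs : 1 ≤ N.sqrt := Nat.sqrt_pos.mpr (by omega)
  rw [tsum_eq_sum (s := Finset.Ioc N.sqrt N) fun n hn => ?_]
  · refine Finset.sum_congr rfl fun n hn => ?_
    have hn1 : 1 < n := by rw [Finset.mem_Ioc] at hn; omega
    have hmem := (scalePoint_mem_Ico_iff hN (by omega)).mpr hn
    have hln : 0 < Real.log n := Real.log_pos (by exact_mod_cast hn1)
    rw [Set.indicator_of_mem hmem, invMulLog_of_mem (Set.Ico_subset_Icc_self hmem), scaleWeight]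
    have hp : scalePoint N n ≠ 0 := (Real.exp_pos _).ne'
    have hlog : Real.log (scalePoint N n) = -(Real.log n / Real.log N) := Real.log_exp _
    have hn0 : (n : ℝ) ≠ 0 := by positivity
    rw [hlog]
    field_simp
  · rcases Nat.eq_zero_or_pos n with rfl | hn0
    · simp [scaleWeight, ha]
    · rw [Set.indicator_of_notMem (mt (scalePoint_mem_Ico_iff hN hn0).mp hn), mul_zero]

theorem tendsto_sum_residueClass_div {a : ZMod d} (ha : IsUnit a) :
    Tendsto (fun N : ℕ => ∑ n ∈ Finset.Ioc N.sqrt N, residueClass a n / (n * Real.log n)) atTop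
      (𝓝 ((d.totient : ℝ)⁻¹ * Real.log 2)) := by
  have h := tendsto_tsum_mul_indicator
    (fun N n => mul_nonneg (div_nonneg (residueClass_nonneg a n)
      (mul_nonneg (Nat.cast_nonneg n) (Real.log_natCast_nonneg N))) (scalePoint_mem N n).1)
    (summable_scaleWeight_residueClass a) scalePoint_mem (tendsto_moments_residueClass ha)
    (by positivity) continuous_invMulLog invMulLog_nonneg (Real.exp_pos (-1)).le exp_neg_one_le
    (Real.exp_le_one_iff.mpr (by norm_num))
  rw [integral_invMulLog] at h
  refine h.congr' ?_
  filter_upwards [eventually_ge_atTop 2] with N hN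
  exact tsum_scaleWeight_mul_indicator (residueClass_apply_zero a) hN

/-- `∑ Λ(n) / n` over nonprimes converges, and `1 / log n ≤ 2 / log N` for `n > √N`. -/
theorem tendsto_sum_nonprime {d : ℕ} (a : ZMod d) :
    Tendsto (fun N : ℕ => ∑ n ∈ Finset.Ioc N.sqrt N,
      (if n.Prime then 0 else residueClass a n) / (n * Real.log n)) atTop (𝓝 0) := by
  have hlog : Tendsto (fun N : ℕ => Real.log N) atTop atTop :=
    Real.tendsto_log_atTop.comp tendsto_natCast_atTop_atTop
  have hb0 : ∀ n : ℕ, 0 ≤ (if n.Prime then 0 else residueClass a n) := fun n => by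
    split_ifs
    exacts [le_rfl, residueClass_nonneg a n]
  set C := ∑' n : ℕ, (if n.Prime then 0 else residueClass a n) / n with hC
  refine squeeze_zero' (g := fun N : ℕ => 2 * C / Real.log N) ?_ ?_
    (tendsto_const_nhds.div_atTop hlog)
  · exact Eventually.of_forall fun N => Finset.sum_nonneg fun n _ =>
      div_nonneg (hb0 n) (mul_nonneg (Nat.cast_nonneg n) (Real.log_natCast_nonneg n))
  · filter_upwards [eventually_ge_atTop 2] with N hN
    have hL : 0 < Real.log N := Real.log_pos (by exact_mod_cast hN)
    have h1 : ∑ n ∈ Finset.Ioc N.sqrt N, (if n.Prime then 0 else residueClass a n) / (n : ℝ) ≤ C :=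
      (summable_residueClass_non_primes_div a).sum_le_tsum _ fun n _ =>
        div_nonneg (hb0 n) (Nat.cast_nonneg n)
    have hs : 1 ≤ N.sqrt := Nat.sqrt_pos.mpr (by omega)
    calc _ ≤ ∑ n ∈ Finset.Ioc N.sqrt N,
          2 / Real.log N * ((if n.Prime then 0 else residueClass a n) / (n : ℝ)) := by
          refine Finset.sum_le_sum fun n hn => ?_
          rw [Finset.mem_Ioc] at hn
          have hn0 : (0 : ℝ) < n := by exact_mod_cast (by omega : 0 < n)
          have hln : 0 < Real.log n := Real.log_pos (by exact_mod_cast (by omega : 1 < n))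
          have h2 : (N : ℝ) ≤ (n : ℝ) ^ 2 := by
            rw [sq]
            exact_mod_cast (Nat.sqrt_lt.mp hn.1).le
          have h3 := Real.log_le_log (by positivity) h2
          rw [Real.log_pow] at h3
          push_cast at h3
          rw [← div_div, div_eq_mul_inv _ (Real.log n), mul_comm]
          refine mul_le_mul_of_nonneg_right ?_ (div_nonneg (hb0 n) hn0.le)
          rw [inv_eq_one_div, div_le_div_iff₀ hln hL]
          linarith
      _ ≤ 2 * C / Real.log N := by
          rw [← Finset.mul_sum, div_mul_eq_mul_div]
          gcongr

/-- Primes `≡ 1 mod d` between `√N` and `N`: the reciprocal sum tends to `log 2 / φ d`. -/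
theorem tendsto_sum_inv_primes {d : ℕ} (hd : d ≠ 0) :
    Tendsto (fun N : ℕ => ∑ p ∈ (Finset.Ioc N.sqrt N).filter (fun p => p.Prime ∧ d ∣ p - 1),
      (1 : ℝ) / p) atTop (𝓝 (Real.log 2 / d.totient)) := by
  have : NeZero d := ⟨hd⟩
  have h := (tendsto_sum_residueClass_div (isUnit_one (M := ZMod d))).sub
    (tendsto_sum_nonprime (1 : ZMod d))
  rw [sub_zero, inv_mul_eq_div] at h
  refine h.congr fun N => ?_
  rw [← Finset.sum_sub_distrib, Finset.sum_filter]
  refine Finset.sum_congr rfl fun n hn => ?_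
  by_cases hp : n.Prime
  · have hiff : (n : ZMod d) = 1 ↔ d ∣ n - 1 := by
      rw [← Nat.modEq_iff_dvd' hp.one_le, ← ZMod.natCast_eq_natCast_iff, Nat.cast_one, eq_comm]
    have hl : Real.log n ≠ 0 := (Real.log_pos (by exact_mod_cast hp.one_lt)).ne'
    have hn0 : (n : ℝ) ≠ 0 := by exact_mod_cast hp.ne_zero
    by_cases h1 : d ∣ n - 1
    · simp only [residueClass, Set.indicator_apply, Set.mem_ofPred_eq, hiff, hp, h1, if_true,
        and_self, vonMangoldt_apply_prime hp]
      field_simp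
      simp
    · simp [residueClass, hiff, hp, h1]
  · simp [hp]

end ReciprocalSums

/-! ### A Chebyshev-type bound uniform in the modulus -/

section UpperBound

open Finset

theorem prod_Icc_add_eq_ascFactorial (r K : ℕ) :
    ∏ k ∈ Icc 1 K, (k + r) = (r + 1).ascFactorial K := by
  induction K with
  | zero => simp
  | succ K ih =>
    rw [prod_Icc_succ_top (by omega), ih, Nat.ascFactorial_succ]
    ring

/-- The part of `K!` prime to `q` divides `∏_{k ≤ K} (q k + 1)`. -/
theorem dvd_prod_mul_add_one {q K M : ℕ} (hM : M ∣ K.factorial) (hq : q.Coprime M) :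
    M ∣ ∏ k ∈ Icc 1 K, (q * k + 1) := by
  rcases Nat.eq_zero_or_pos M with rfl | hM0
  · exact absurd (zero_dvd_iff.mp hM) K.factorial_ne_zero
  have : NeZero M := ⟨hM0.ne'⟩
  rw [← ZMod.natCast_eq_zero_iff]
  -- With `r` inverse to `q` modulo `M`, `q k + 1 = q (k + r)`; a product of `K` consecutive
  -- integers is divisible by `K!`.
  obtain ⟨r, hr⟩ : ∃ r : ℕ, ((q : ZMod M)) * r = 1 :=
    ⟨((q : ZMod M)⁻¹).val, by rw [ZMod.natCast_zmod_val]; exact ZMod.coe_mul_inv_eq_one q hq⟩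
  have h1 : M ∣ ∏ k ∈ Icc 1 K, (k + r) := by
    refine hM.trans ?_
    rw [prod_Icc_add_eq_ascFactorial]
    exact Nat.factorial_dvd_ascFactorial _ _
  rw [← ZMod.natCast_eq_zero_iff] at h1
  push_cast at h1 ⊢
  have : ∏ k ∈ Icc 1 K, ((q : ZMod M) * k + 1) = (q : ZMod M) ^ K * ∏ k ∈ Icc 1 K, ((k : ZMod M) + r) := by
    rw [← hr]
    simp_rw [← mul_add]
    rw [prod_mul_distrib]
    simp
  rw [this, h1, mul_zero]

theorem factorial_dvd_pow_mul_prod {q K : ℕ} (hq : q.Prime) :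
    K.factorial ∣ q ^ K * ∏ k ∈ Icc 1 K, (q * k + 1) := by
  obtain ⟨e, M, hM, hK⟩ := Nat.exists_eq_pow_mul_and_not_dvd K.factorial_ne_zero q hq.ne_one
  -- Legendre: `(q - 1) v_q(K!)` is `K` minus the digit sum of `K` in base `q`.
  have he : e ≤ K := by
    have h1 : q ^ e ∣ K.factorial := ⟨M, hK⟩
    have := Fact.mk hq
    have h2 : e ≤ padicValNat q K.factorial :=
      (padicValNat_dvd_iff_le K.factorial_ne_zero).mp h1
    have h3 := sub_one_mul_padicValNat_factorial (p := q) K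
    have h4 : 1 ≤ q - 1 := by have := hq.two_le; omega
    nlinarith [Nat.sub_le K (Nat.digits q K).sum]
  rw [hK]
  refine mul_dvd_mul (pow_dvd_pow q he) ?_
  exact dvd_prod_mul_add_one (K := K) ⟨q ^ e, by rw [hK, mul_comm]⟩ ((hq.coprime_iff_not_dvd).mpr hM)

/-- Each such prime is `q k + 1` with `k ≤ K = 2X / q`, and exceeds `X ≥ K`, so their product `P` is
coprime to `K!`. Hence `P * K!` divides `q ^ K * ∏ (q k + 1)`, which is at most `(q (q + 1)) ^ K *
K!`. -/
theorem prod_primes_le {q X : ℕ} (hq : q.Prime) :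
    ∏ p ∈ (Ioc X (2 * X)).filter (fun p => p.Prime ∧ q ∣ p - 1), p ≤
      (q * (q + 1)) ^ (2 * X / q) := by
  set K := 2 * X / q with hKdef
  set P := ∏ p ∈ (Ioc X (2 * X)).filter (fun p => p.Prime ∧ q ∣ p - 1), p with hP
  have hKX : K ≤ X := by
    rw [hKdef]
    exact (Nat.div_le_div_left hq.two_le two_pos).trans (by simp)
  have hPdvd : P ∣ ∏ k ∈ Icc 1 K, (q * k + 1) := by
    have : P = ∏ k ∈ (((Ioc X (2 * X)).filter (fun p => p.Prime ∧ q ∣ p - 1)).image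
        fun p => (p - 1) / q), (q * k + 1) := by
      rw [prod_image]
      · refine prod_congr rfl fun p hp => ?_
        simp only [mem_filter, mem_Ioc] at hp
        rw [Nat.mul_div_cancel' hp.2.2]
        have := hp.2.1.pos
        omega
      · intro p hp p' hp' h
        simp only [coe_filter, mem_Ioc, Set.mem_ofPred_eq] at hp hp'
        have h1 := Nat.mul_div_cancel' hp.2.2
        have h2 := Nat.mul_div_cancel' hp'.2.2
        simp only at h
        rw [h, h2] at h1
        have := hp.2.1.pos
        have := hp'.2.1.pos
        omega
    rw [this]
    refine prod_dvd_prod_of_subset _ _ _ fun k hk => ?_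
    simp only [mem_image, mem_filter, mem_Ioc] at hk
    obtain ⟨p, ⟨⟨hp1, hp2⟩, hp3, hp4⟩, rfl⟩ := hk
    rw [mem_Icc]
    have := hp3.two_le
    exact ⟨Nat.div_pos (Nat.le_of_dvd (by omega) hp4) hq.pos, Nat.div_le_div_right (by omega)⟩
  have hcop : P.Coprime K.factorial := by
    refine Nat.Coprime.prod_left fun p hp => ?_
    simp only [mem_filter, mem_Ioc] at hp
    rw [hp.2.1.coprime_iff_not_dvd, hp.2.1.dvd_factorial]
    omega
  have h1 : P * K.factorial ∣ q ^ K * ∏ k ∈ Icc 1 K, (q * k + 1) :=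
    hcop.mul_dvd_of_dvd_of_dvd (hPdvd.mul_left _) (factorial_dvd_pow_mul_prod hq)
  have h2 : P * K.factorial ≤ q ^ K * ∏ k ∈ Icc 1 K, (q * k + 1) :=
    Nat.le_of_dvd (Nat.mul_pos (pow_pos hq.pos _) (prod_pos fun _ _ => by omega)) h1
  have h3 : ∏ k ∈ Icc 1 K, (q * k + 1) ≤ (q + 1) ^ K * K.factorial := by
    calc ∏ k ∈ Icc 1 K, (q * k + 1) ≤ ∏ k ∈ Icc 1 K, ((q + 1) * k) := by
          refine prod_le_prod' fun k hk => ?_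
          rw [mem_Icc] at hk
          nlinarith [hk.1]
      _ = _ := by
          have h := prod_Icc_add_eq_ascFactorial 0 K
          rw [zero_add, Nat.one_ascFactorial] at h
          rw [prod_mul_distrib, ← h]
          simp
  refine Nat.le_of_mul_le_mul_right (h2.trans ?_) K.factorial_pos
  rw [mul_pow, mul_assoc]
  exact Nat.mul_le_mul_left _ h3

theorem sum_log_div_le {q X : ℕ} (hq : q.Prime) (hX : 0 < X) :
    ∑ p ∈ (Ioc X (2 * X)).filter (fun p => p.Prime ∧ q ∣ p - 1), Real.log p / p ≤
      4 * Real.log (q + 1) / q := by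
  have hX' : (0 : ℝ) < X := by exact_mod_cast hX
  have hq' : (0 : ℝ) < q := by exact_mod_cast hq.pos
  have hlog : ∑ p ∈ (Ioc X (2 * X)).filter (fun p => p.Prime ∧ q ∣ p - 1), Real.log p ≤
      (2 * X / q) * (2 * Real.log (q + 1)) := by
    have h := prod_primes_le (X := X) hq
    have h' : (∏ p ∈ (Ioc X (2 * X)).filter (fun p => p.Prime ∧ q ∣ p - 1), (p : ℝ)) ≤
        ((q : ℝ) * (q + 1)) ^ (2 * X / q) := by
      rw [← Nat.cast_prod]
      exact_mod_cast h
    have hpos : ∀ p ∈ (Ioc X (2 * X)).filter (fun p => p.Prime ∧ q ∣ p - 1), (0 : ℝ) < p := by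
      intro p hp
      simp only [mem_filter] at hp
      exact_mod_cast hp.2.1.pos
    rw [← Real.log_prod (fun p hp => (hpos p hp).ne')]
    refine (Real.log_le_log (prod_pos hpos) h').trans ?_
    rw [Real.log_pow, Real.log_mul hq'.ne' (by positivity)]
    have h1 : Real.log q ≤ Real.log (q + 1) := Real.log_le_log hq' (by linarith)
    have h2 : ((2 * X / q : ℕ) : ℝ) ≤ 2 * X / q := by
      have := Nat.cast_div_le (α := ℝ) (m := 2 * X) (n := q)
      push_cast at this
      exact this
    have h3 : 0 ≤ Real.log q := Real.log_nonneg (by exact_mod_cast hq.one_le)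
    exact mul_le_mul h2 (by linarith) (by linarith) (by positivity)
  calc _ ≤ ∑ p ∈ (Ioc X (2 * X)).filter (fun p => p.Prime ∧ q ∣ p - 1), Real.log p / X := by
        refine sum_le_sum fun p hp => ?_
        simp only [mem_filter, mem_Ioc] at hp
        have : (X : ℝ) ≤ p := by exact_mod_cast hp.1.1.le
        exact div_le_div_of_nonneg_left (Real.log_nonneg (by exact_mod_cast hp.2.1.one_le)) hX' this
    _ ≤ _ := by
        rw [← sum_div, div_le_iff₀ hX']
        refine hlog.trans (le_of_eq ?_)
        field_simp
        ring

/-- Dyadic decomposition: each block `(2 ^ i, 2 ^ (i + 1)]` contributes at most `4 log (q + 1) / q`,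
and at most `3 log N` blocks are needed. -/
theorem sum_log_div_le_mul_log {q N : ℕ} (hq : q.Prime) (hN : 2 ≤ N) :
    ∑ p ∈ (Icc 1 N).filter (fun p => p.Prime ∧ q ∣ p - 1), Real.log p / p ≤
      12 * Real.log (q + 1) / q * Real.log N := by
  set B := 4 * Real.log (q + 1) / q with hB
  have hq' : (0 : ℝ) < q := by exact_mod_cast hq.pos
  have hB0 : 0 ≤ B := by
    have : 0 ≤ Real.log ((q : ℝ) + 1) := Real.log_nonneg (by linarith)
    positivity
  have hpow : ∀ i : ℕ, ∑ p ∈ (Icc 1 (2 ^ i)).filter (fun p => p.Prime ∧ q ∣ p - 1),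
      Real.log p / p ≤ i * B := by
    intro i
    induction i with
    | zero => simp [Finset.sum_filter, Nat.not_prime_one]
    | succ i ih =>
      have hu : Icc 1 (2 ^ (i + 1)) = Icc 1 (2 ^ i) ∪ Ioc (2 ^ i) (2 * 2 ^ i) := by
        ext x
        simp only [mem_Icc, mem_union, mem_Ioc, pow_succ]
        have : 0 < 2 ^ i := by positivity
        omega
      rw [hu, filter_union, sum_union]
      · have := sum_log_div_le (X := 2 ^ i) hq (by positivity)
        push_cast
        linarith
      · refine disjoint_filter_filter ?_
        rw [disjoint_left]
        intro x hx hx'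
        rw [mem_Icc] at hx
        rw [mem_Ioc] at hx'
        omega
  have hlt : N ≤ 2 ^ (Nat.log 2 N + 1) := (Nat.lt_pow_succ_log_self one_lt_two N).le
  have h1 : ∑ p ∈ (Icc 1 N).filter (fun p => p.Prime ∧ q ∣ p - 1), Real.log p / p ≤
      ((Nat.log 2 N + 1 : ℕ) : ℝ) * B := by
    refine le_trans (sum_le_sum_of_subset_of_nonneg
      (filter_subset_filter _ (Icc_subset_Icc_right hlt)) fun p hp _ => ?_) (hpow _)
    simp only [mem_filter, mem_Icc] at hp
    exact div_nonneg (Real.log_nonneg (by exact_mod_cast hp.1.1)) (by positivity)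
  have hlog2 : (0.69 : ℝ) < Real.log 2 := by linarith [Real.log_two_gt_d9]
  have hlogN : Real.log 2 ≤ Real.log N := Real.log_le_log two_pos (by exact_mod_cast hN)
  have h2 : ((Nat.log 2 N + 1 : ℕ) : ℝ) ≤ 3 * Real.log N := by
    have h3 : (2 : ℝ) ^ Nat.log 2 N ≤ N := by exact_mod_cast Nat.pow_log_le_self 2 (by omega)
    have h4 := Real.log_le_log (by positivity) h3
    rw [Real.log_pow] at h4
    push_cast
    nlinarith
  refine h1.trans ((mul_le_mul_of_nonneg_right h2 hB0).trans (le_of_eq ?_))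
  rw [hB]
  ring

/-- Uniform upper bound for the reciprocal sum of primes `≡ 1 mod q` between `√N` and `N`. -/
theorem sum_inv_primes_le {q N : ℕ} (hq : q.Prime) (hN : 2 ≤ N) :
    ∑ p ∈ (Ioc N.sqrt N).filter (fun p => p.Prime ∧ q ∣ p - 1), (1 : ℝ) / p ≤
      24 * Real.log (q + 1) / q := by
  have hlogN : 0 < Real.log N := Real.log_pos (by exact_mod_cast hN)
  have h1 : ∑ p ∈ (Ioc N.sqrt N).filter (fun p => p.Prime ∧ q ∣ p - 1), (1 : ℝ) / p ≤
      -- Above `√N`, `log p ≥ log N / 2`, which doubles the constant to `24`.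
      ∑ p ∈ (Ioc N.sqrt N).filter (fun p => p.Prime ∧ q ∣ p - 1),
        2 / Real.log N * (Real.log p / p) := by
    refine sum_le_sum fun p hp => ?_
    simp only [mem_filter, mem_Ioc] at hp
    have hp0 : (0 : ℝ) < p := by exact_mod_cast hp.2.1.pos
    have h2 : (N : ℝ) ≤ (p : ℝ) ^ 2 := by
      have := Nat.sqrt_lt.mp hp.1.1
      rw [sq]
      exact_mod_cast this.le
    have h3 := Real.log_le_log (by positivity) h2
    rw [Real.log_pow] at h3
    push_cast at h3
    rw [← mul_div_assoc]
    refine div_le_div_of_nonneg_right ?_ hp0.le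
    rw [div_mul_eq_mul_div, le_div_iff₀ hlogN]
    linarith
  refine h1.trans ?_
  rw [← mul_sum]
  have h4 : ∑ p ∈ (Ioc N.sqrt N).filter (fun p => p.Prime ∧ q ∣ p - 1), Real.log p / p ≤
      12 * Real.log (q + 1) / q * Real.log N := by
    refine le_trans (sum_le_sum_of_subset_of_nonneg
      (filter_subset_filter _ fun x hx => ?_) fun p hp _ => ?_) (sum_log_div_le_mul_log hq hN)
    · rw [mem_Ioc] at hx
      rw [mem_Icc]
      omega
    · simp only [mem_filter, mem_Icc] at hp
      exact div_nonneg (Real.log_nonneg (by exact_mod_cast hp.1.1)) (by positivity)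
  refine (mul_le_mul_of_nonneg_left h4 (by positivity)).trans (le_of_eq ?_)
  field_simp
  ring

end UpperBound

/-! ### Counting pairs by Möbius inversion and truncation -/

section Counting

open Finset Filter Topology

/-- The primes in `(√N, N]`. -/
def largePrimes (N : ℕ) : Finset ℕ := (Ioc N.sqrt N).filter Nat.Prime

theorem mem_largePrimes {N p : ℕ} : p ∈ largePrimes N ↔ (N.sqrt < p ∧ p ≤ N) ∧ p.Prime := by
  simp [largePrimes]

theorem filter_largePrimes (N d : ℕ) :
    (largePrimes N).filter (fun p => d ∣ p - 1) =
      (Ioc N.sqrt N).filter (fun p => p.Prime ∧ d ∣ p - 1) := by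
  rw [largePrimes, filter_filter]

theorem sum_moebius_divisors_gcd (e m : ℕ) (he : e ≠ 0) :
    ∑ d ∈ e.divisors with d ∣ m, ArithmeticFunction.moebius d = if e.Coprime m then 1 else 0 := by
  have h : e.divisors.filter (fun d => d ∣ m) = (e.gcd m).divisors := by
    ext d
    simp only [mem_filter, Nat.mem_divisors, Nat.dvd_gcd_iff, ne_eq, Nat.gcd_eq_zero_iff]
    tauto
  rw [h, ← ArithmeticFunction.coe_mul_zeta_apply, ArithmeticFunction.moebius_mul_coe_zeta,
    ArithmeticFunction.one_apply]

/-- Legendre's formula for the number of `m ≤ M` coprime to `e`. -/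
theorem card_coprime_eq_sum_moebius (e M : ℕ) (he : e ≠ 0) :
    (#{m ∈ Icc 1 M | e.Coprime m} : ℤ) =
      ∑ d ∈ e.divisors, ArithmeticFunction.moebius d * ((M / d : ℕ) : ℤ) := by
  rw [card_filter]
  push_cast
  simp_rw [← sum_moebius_divisors_gcd e _ he, sum_filter]
  rw [sum_comm]
  refine sum_congr rfl fun d _ => ?_
  rw [← sum_filter, sum_const, nsmul_eq_mul, mul_comm]
  congr 2
  exact_mod_cast Nat.Ioc_filter_dvd_card_eq_div M d

/-- The count of pairs `(p, m)` with `√N < p ≤ N`, `m ≤ N / p` and `gcd(p - 1, m) = 1`. -/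
def pairCount (N : ℕ) : ℕ := ∑ p ∈ largePrimes N, #{m ∈ Icc 1 (N / p) | (p - 1).Coprime m}

/-- As `pairCount`, but only common prime factors up to `z` are excluded. -/
def truncatedPairCount (z N : ℕ) : ℕ :=
  ∑ p ∈ largePrimes N, #{m ∈ Icc 1 (N / p) | ((p - 1).gcd (primorial z)).Coprime m}

theorem pairCount_le_truncatedPairCount (z N : ℕ) : pairCount N ≤ truncatedPairCount z N :=
  sum_le_sum fun _ _ => card_le_card <| monotone_filter_right _ fun _ _ h =>
    Nat.Coprime.coprime_dvd_left (Nat.gcd_dvd_left _ _) h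

/-- An `m` admitted only by the truncation shares with `p - 1` a prime `q > z`; a union bound counts
the multiples of each such `q`. -/
theorem card_coprime_gcd_le {z N p : ℕ} (hp : p ∈ largePrimes N) :
    #{m ∈ Icc 1 (N / p) | ((p - 1).gcd (primorial z)).Coprime m} ≤
      #{m ∈ Icc 1 (N / p) | (p - 1).Coprime m} +
        ∑ q ∈ (Ioc z N).filter (fun q => q.Prime ∧ q ∣ p - 1), N / p / q := by
  have hsub : (Icc 1 (N / p)).filter (fun m => ((p - 1).gcd (primorial z)).Coprime m) ⊆
      (Icc 1 (N / p)).filter (fun m => (p - 1).Coprime m) ∪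
        ((Ioc z N).filter (fun q => q.Prime ∧ q ∣ p - 1)).biUnion
          fun q => (Ioc 0 (N / p)).filter (fun m => q ∣ m) := by
    intro m hm
    rw [mem_filter] at hm
    rw [mem_union, mem_filter, mem_biUnion]
    by_cases hc : (p - 1).Coprime m
    · exact Or.inl ⟨hm.1, hc⟩
    · right
      obtain ⟨q, hq, hq1, hq2⟩ := Nat.Prime.not_coprime_iff_dvd.mp hc
      rw [mem_largePrimes] at hp
      have hqle := Nat.le_of_dvd (Nat.sub_pos_of_lt hp.2.one_lt) hq1
      have hzq : z < q := by
        by_contra! hle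
        exact Nat.Prime.not_coprime_iff_dvd.mpr
          ⟨q, hq, Nat.dvd_gcd hq1 (hq.dvd_primorial_iff.mpr hle), hq2⟩ hm.2
      refine ⟨q, mem_filter.mpr ⟨mem_Ioc.mpr ⟨hzq, by omega⟩, hq, hq1⟩,
        mem_filter.mpr ⟨?_, hq2⟩⟩
      have := mem_Icc.mp hm.1
      exact mem_Ioc.mpr ⟨by omega, this.2⟩
  refine (card_le_card hsub).trans ((card_union_le _ _).trans (Nat.add_le_add_left ?_ _))
  refine card_biUnion_le.trans (le_of_eq (sum_congr rfl fun q _ => ?_))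
  exact Nat.Ioc_filter_dvd_card_eq_div _ _

theorem cast_div_div_le (N p d : ℕ) : ((N / p / d : ℕ) : ℝ) ≤ N / d * (1 / p) := by
  rw [Nat.div_div_eq_div_mul]
  refine Nat.cast_div_le.trans (le_of_eq ?_)
  push_cast
  rw [div_mul_div_comm, mul_one, mul_comm (p : ℝ)]

theorem le_cast_div_div (N p d : ℕ) : N / d * (1 / p) - 1 ≤ ((N / p / d : ℕ) : ℝ) := by
  rw [Nat.div_div_eq_div_mul]
  have h := (Nat.lt_floor_add_one ((N : ℝ) / ((p * d : ℕ) : ℝ))).le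
  rw [Nat.floor_div_eq_div] at h
  push_cast at h ⊢
  rw [div_mul_div_comm, mul_one, mul_comm (d : ℝ)]
  linarith

theorem truncatedPairCount_le {z N : ℕ} (hN : 2 ≤ N) :
    (truncatedPairCount z N : ℝ) ≤ pairCount N +
      N * ∑ q ∈ Ioc z N, 24 * Real.log (q + 1) / (q : ℝ) ^ 2 := by
  have h1 : truncatedPairCount z N ≤ pairCount N +
      ∑ p ∈ largePrimes N, ∑ q ∈ (Ioc z N).filter (fun q => q.Prime ∧ q ∣ p - 1), N / p / q := by
    rw [pairCount, ← sum_add_distrib]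
    exact sum_le_sum fun p hp => card_coprime_gcd_le hp
  have h2 : ∑ p ∈ largePrimes N, ∑ q ∈ (Ioc z N).filter (fun q => q.Prime ∧ q ∣ p - 1), N / p / q =
      ∑ q ∈ (Ioc z N).filter Nat.Prime,
        ∑ p ∈ (largePrimes N).filter (fun p => q ∣ p - 1), N / p / q := by
    simp_rw [← filter_filter, sum_filter (fun q => q ∣ _ - 1)]
    rw [sum_comm]
    refine sum_congr rfl fun q _ => ?_
    rw [sum_filter]
  rw [h2] at h1
  have h1' : (truncatedPairCount z N : ℝ) ≤ pairCount N + ∑ q ∈ (Ioc z N).filter Nat.Prime,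
        ∑ p ∈ (largePrimes N).filter (fun p => q ∣ p - 1), ((N / p / q : ℕ) : ℝ) := by
    exact_mod_cast h1
  refine h1'.trans (add_le_add_right ?_ _)
  rw [mul_sum]
  have hpos : ∀ q : ℕ, 0 ≤ (N : ℝ) * (24 * Real.log (q + 1) / (q : ℝ) ^ 2) := fun q => by
    have : 0 ≤ Real.log ((q : ℝ) + 1) := Real.log_nonneg (by linarith [q.cast_nonneg (α := ℝ)])
    positivity
  refine le_trans (sum_le_sum fun q hq => ?_)
    (sum_le_sum_of_subset_of_nonneg (filter_subset _ _) fun q _ _ => hpos q)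
  have hq := (mem_filter.mp hq).2
  have hq0 : (0 : ℝ) < q := by exact_mod_cast hq.pos
  calc _ ≤ ∑ p ∈ (largePrimes N).filter (fun p => q ∣ p - 1), (N : ℝ) / q * (1 / p) :=
        sum_le_sum fun p _ => cast_div_div_le N p q
    _ ≤ N / q * (24 * Real.log (q + 1) / q) := by
        rw [← mul_sum, filter_largePrimes]
        exact mul_le_mul_of_nonneg_left (sum_inv_primes_le hq hN) (by positivity)
    _ = _ := by field_simp

theorem truncatedPairCount_eq (z N : ℕ) :
    (truncatedPairCount z N : ℝ) = ∑ d ∈ (primorial z).divisors,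
      (ArithmeticFunction.moebius d : ℝ) *
        ∑ p ∈ (largePrimes N).filter (fun p => d ∣ p - 1), ((N / p / d : ℕ) : ℝ) := by
  have h : (truncatedPairCount z N : ℤ) = ∑ d ∈ (primorial z).divisors,
      ArithmeticFunction.moebius d *
        ∑ p ∈ (largePrimes N).filter (fun p => d ∣ p - 1), ((N / p / d : ℕ) : ℤ) := by
    rw [truncatedPairCount]
    push_cast
    have h1 : ∀ p ∈ largePrimes N,
        (#{m ∈ Icc 1 (N / p) | ((p - 1).gcd (primorial z)).Coprime m} : ℤ) =
        ∑ d ∈ (primorial z).divisors, if d ∣ p - 1 then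
          ArithmeticFunction.moebius d * ((N / p / d : ℕ) : ℤ) else 0 := by
      intro p hp
      rw [card_coprime_eq_sum_moebius _ _ (Nat.gcd_pos_of_pos_right _ (primorial_pos z)).ne',
        ← sum_filter]
      refine sum_congr ?_ fun _ _ => rfl
      ext d
      simp only [mem_filter, Nat.mem_divisors, Nat.dvd_gcd_iff, ne_eq, Nat.gcd_eq_zero_iff,
        primorial_ne_zero z, and_false, not_false_eq_true, and_true]
      tauto
    rw [sum_congr rfl h1, sum_comm]
    refine sum_congr rfl fun d _ => ?_
    rw [← sum_filter, mul_sum]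
    push_cast
    rfl
  have h' := congrArg (fun x : ℤ => (x : ℝ)) h
  push_cast at h' ⊢
  exact h'

theorem tendsto_primeCounting_div : Tendsto (fun N : ℕ => (Nat.primeCounting N : ℝ) / N) atTop
    (𝓝 0) := by
  have hlog : Tendsto (fun N : ℕ => Real.log N) atTop atTop :=
    Real.tendsto_log_atTop.comp tendsto_natCast_atTop_atTop
  have h := tendsto_natCast_atTop_atTop.eventually
    (Chebyshev.eventually_primeCounting_le (ε := 1) one_pos)
  refine squeeze_zero' (g := fun N : ℕ => (Real.log 4 + 1) / Real.log N)
    (Eventually.of_forall fun N => by positivity) ?_ (tendsto_const_nhds.div_atTop hlog)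
  filter_upwards [h, eventually_ge_atTop 1] with N hN h1
  have hN0 : (0 : ℝ) < N := by exact_mod_cast h1
  rw [Nat.floor_natCast] at hN
  rw [div_le_iff₀ hN0]
  refine hN.trans (le_of_eq ?_)
  ring

theorem card_largePrimes_le (N : ℕ) : #(largePrimes N) ≤ Nat.primeCounting N := by
  rw [← Nat.primesLE_card_eq_primeCounting]
  refine card_le_card fun p hp => ?_
  rw [mem_largePrimes] at hp
  exact Nat.mem_primesLE.mpr ⟨hp.1.2, hp.2⟩

/-- Dropping the floor costs at most `1` per prime, in total at most `π(N) = o(N)`. -/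
theorem tendsto_sum_floor_div {d : ℕ} (hd : d ≠ 0) :
    Tendsto (fun N : ℕ => (∑ p ∈ (largePrimes N).filter (fun p => d ∣ p - 1),
      ((N / p / d : ℕ) : ℝ)) / N) atTop (𝓝 (Real.log 2 / (d * d.totient))) := by
  have h := (tendsto_sum_inv_primes hd).div_const (d : ℝ)
  have e : Real.log 2 / d.totient / d = Real.log 2 / (d * d.totient) := by
    rw [div_div, mul_comm]
  rw [e] at h
  have h' := h.sub tendsto_primeCounting_div
  rw [sub_zero] at h'
  refine tendsto_of_tendsto_of_tendsto_of_le_of_le' h' h ?_ ?_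
  · filter_upwards [eventually_ge_atTop 1] with N hN
    have hN0 : (0 : ℝ) < N := by exact_mod_cast hN
    rw [le_div_iff₀ hN0, ← filter_largePrimes]
    have h1 : ∑ p ∈ (largePrimes N).filter (fun p => d ∣ p - 1), ((N : ℝ) / d * (1 / p) - 1) ≤
        ∑ p ∈ (largePrimes N).filter (fun p => d ∣ p - 1), ((N / p / d : ℕ) : ℝ) :=
      sum_le_sum fun p _ => le_cast_div_div N p d
    refine le_trans ?_ h1
    rw [sum_sub_distrib, ← mul_sum, sum_const, nsmul_eq_mul, mul_one, sub_mul,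
      div_mul_cancel₀ _ hN0.ne']
    have h2 : (#((largePrimes N).filter (fun p => d ∣ p - 1)) : ℝ) ≤ Nat.primeCounting N := by
      exact_mod_cast (card_filter_le _ _).trans (card_largePrimes_le N)
    refine sub_le_sub (le_of_eq ?_) h2
    ring
  · filter_upwards [eventually_ge_atTop 1] with N hN
    have hN0 : (0 : ℝ) < N := by exact_mod_cast hN
    rw [div_le_iff₀ hN0, ← filter_largePrimes]
    refine (sum_le_sum fun p _ => cast_div_div_le N p d).trans (le_of_eq ?_)
    rw [← mul_sum]
    ring

/-- The arithmetic function `d ↦ 1 / (d φ d)`. -/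
noncomputable def invMulTotient : ArithmeticFunction ℝ :=
  ⟨fun d => 1 / (d * d.totient), by simp⟩

theorem isMultiplicative_invMulTotient : invMulTotient.IsMultiplicative := by
  refine ⟨by simp [invMulTotient], fun {m n} h => ?_⟩
  simp only [invMulTotient, ArithmeticFunction.coe_mk, Nat.totient_mul h]
  push_cast
  rw [div_mul_div_comm, one_mul]
  congr 1
  ring

theorem tendsto_truncatedPairCount (z : ℕ) :
    Tendsto (fun N : ℕ => (truncatedPairCount z N : ℝ) / N) atTop
      (𝓝 (Real.log 2 * ∏ p ∈ Nat.primesLE z, (1 - 1 / ((p : ℝ) * (p - 1))))) := by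
  have h : Tendsto (fun N : ℕ => (truncatedPairCount z N : ℝ) / N) atTop
      (𝓝 (∑ d ∈ (primorial z).divisors, (ArithmeticFunction.moebius d : ℝ) *
        (Real.log 2 / (d * d.totient)))) := by
    simp_rw [truncatedPairCount_eq, sum_div, mul_div_assoc]
    exact tendsto_finsetSum _ fun d hd =>
      (tendsto_sum_floor_div (Nat.pos_of_mem_divisors hd).ne').const_mul _
  convert h using 2
  have h1 := isMultiplicative_invMulTotient.prodPrimeFactors_one_sub_of_squarefree
    _ (squarefree_primorial z)
  rw [primeFactors_primorial] at h1
  have h2 : ∏ p ∈ Nat.primesLE z, (1 - 1 / ((p : ℝ) * (p - 1))) =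
      ∏ p ∈ Nat.primesLE z, (1 - invMulTotient p) := by
    refine prod_congr rfl fun p hp => ?_
    have hp := Nat.prime_of_mem_primesLE hp
    simp [invMulTotient, Nat.totient_prime hp, Nat.cast_sub hp.one_le]
  rw [h2, h1, mul_sum]
  refine sum_congr rfl fun d _ => ?_
  simp only [invMulTotient, ArithmeticFunction.coe_mk]
  ring

end Counting

/-! ### From pairs to the natural density -/

section Density

open Finset Filter Topology

/-- The integers whose largest prime factor `p` exceeds `√n` and satisfies `gcd(p - 1, n) = 1`. -/
def largeCoprimeSet : Set ℕ :=
  {n : ℕ | ∃ p : ℕ, IsLargestPrimeFactor p n ∧ Real.sqrt (n : ℝ) < (p : ℝ) ∧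
    Nat.gcd (p - 1) n = 1}

/-- The pairs `(p, m)` counted by `pairCount`. -/
def largePairs (N : ℕ) : Finset (Σ _ : ℕ, ℕ) :=
  (largePrimes N).sigma fun p => (Icc 1 (N / p)).filter fun m => (p - 1).Coprime m

theorem mem_largePairs {N : ℕ} {x : Σ _ : ℕ, ℕ} : x ∈ largePairs N ↔
    x.1 ∈ largePrimes N ∧ (1 ≤ x.2 ∧ x.2 ≤ N / x.1) ∧ (x.1 - 1).Coprime x.2 := by
  simp [largePairs, mem_sigma]

theorem card_largePairs (N : ℕ) : #(largePairs N) = pairCount N := card_sigma _ _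

theorem isLargestPrimeFactor_mul {p m : ℕ} (hp : p.Prime) (hm : 1 ≤ m) (hmp : m < p) :
    IsLargestPrimeFactor p (p * m) := by
  refine ⟨⟨hp, dvd_mul_right _ _⟩, fun q hq => ?_⟩
  rcases (hq.1.dvd_mul).mp hq.2 with h | h
  · exact Nat.le_of_dvd hp.pos h
  · exact (Nat.le_of_dvd hm h).trans hmp.le

theorem lt_of_mem_largePrimes {N p m : ℕ} (hp : p ∈ largePrimes N) (hm : m ≤ N / p) : m < p := by
  rw [mem_largePrimes] at hp
  exact hm.trans_lt ((Nat.div_lt_iff_lt_mul hp.2.pos).mpr (Nat.sqrt_lt.mp hp.1.1))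

theorem gcd_sub_one_self {p : ℕ} (hp : p.Prime) : (p - 1).Coprime p :=
  (Nat.coprime_self_sub_right hp.one_le |>.mpr (Nat.coprime_one_right p)).symm

theorem pairCount_le_ncard (N : ℕ) : pairCount N ≤ (largeCoprimeSet ∩ Set.Icc 1 N).ncard := by
  rw [← card_largePairs, ← Set.ncard_coe_finset]
  refine Set.ncard_le_ncard_of_injOn (fun x => x.1 * x.2) (fun x hx => ?_) (fun x hx y hy h => ?_)
    ((Set.finite_Icc 1 N).inter_of_right _)
  · rw [mem_coe, mem_largePairs] at hx
    obtain ⟨h1, ⟨h2, h3⟩, h4⟩ := hx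
    have hlt := lt_of_mem_largePrimes h1 h3
    have hp := (mem_largePrimes.mp h1).2
    refine ⟨⟨x.1, isLargestPrimeFactor_mul hp h2 hlt, ?_, ?_⟩, ?_, ?_⟩
    · rw [Real.sqrt_lt' (by exact_mod_cast hp.pos), sq]
      exact_mod_cast Nat.mul_lt_mul_of_pos_left hlt hp.pos
    · exact Nat.Coprime.mul_right (gcd_sub_one_self hp) h4
    · exact Nat.mul_pos hp.pos h2
    · exact (Nat.mul_le_mul_left _ h3).trans (Nat.mul_div_le _ _)
  · rw [mem_coe, mem_largePairs] at hx hy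
    have hx' := isLargestPrimeFactor_mul (mem_largePrimes.mp hx.1).2 hx.2.1.1
      (lt_of_mem_largePrimes hx.1 hx.2.1.2)
    have hy' := isLargestPrimeFactor_mul (mem_largePrimes.mp hy.1).2 hy.2.1.1
      (lt_of_mem_largePrimes hy.1 hy.2.1.2)
    obtain ⟨p, m⟩ := x
    obtain ⟨p', m'⟩ := y
    simp only at h hx' hy'
    rw [h] at hx'
    obtain rfl : p = p' := hx'.unique hy'
    obtain rfl : m = m' := Nat.eq_of_mul_eq_mul_left (mem_largePrimes.mp hx.1).2.pos h
    rfl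

/-- The integers missed by the pairs are `p m` with `m < p ≤ √N`, at most `π(√N) √N` of them. -/
theorem ncard_le_pairCount_add (N : ℕ) : (largeCoprimeSet ∩ Set.Icc 1 N).ncard ≤
    pairCount N + Nat.primeCounting N.sqrt * N.sqrt := by
  have hsub : largeCoprimeSet ∩ Set.Icc 1 N ⊆
      (((largePairs N).image fun x => x.1 * x.2) ∪
        (Nat.primesLE N.sqrt ×ˢ range N.sqrt).image fun x => x.1 * x.2 : Finset ℕ) := by
    rintro n ⟨⟨p, ⟨⟨hp, m, rfl⟩, -⟩, hs, hg⟩, h1, hN⟩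
    rw [Real.sqrt_lt' (by exact_mod_cast hp.pos), sq] at hs
    have hmp : m < p := lt_of_mul_lt_mul_left (by exact_mod_cast hs) (Nat.zero_le p)
    have hm : 1 ≤ m := Nat.pos_of_ne_zero fun h => by simp [h] at h1
    rw [coe_union, coe_image, coe_image]
    by_cases h : N.sqrt < p
    · left
      refine ⟨⟨p, m⟩, ?_, rfl⟩
      rw [mem_coe, mem_largePairs, mem_largePrimes]
      refine ⟨⟨⟨h, (Nat.le_mul_of_pos_right p hm).trans hN⟩, hp⟩, ⟨hm, ?_⟩,
        Nat.Coprime.coprime_mul_left_right hg⟩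
      rw [Nat.le_div_iff_mul_le hp.pos, mul_comm]
      exact hN
    · right
      refine ⟨(p, m), ?_, rfl⟩
      rw [mem_coe, mem_product, Nat.mem_primesLE, mem_range]
      exact ⟨⟨not_lt.mp h, hp⟩, by omega⟩
  refine (Set.ncard_le_ncard hsub (Finset.finite_toSet _)).trans ?_
  rw [Set.ncard_coe_finset]
  refine (card_union_le _ _).trans (Nat.add_le_add ?_ ?_)
  · exact card_image_le.trans (card_largePairs N).le
  · refine card_image_le.trans (le_of_eq ?_)
    rw [card_product, Nat.primesLE_card_eq_primeCounting, card_range]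

theorem tendsto_primeCounting_sqrt_mul_sqrt_div :
    Tendsto (fun N : ℕ => ((Nat.primeCounting N.sqrt * N.sqrt : ℕ) : ℝ) / N) atTop (𝓝 0) := by
  have hsqrt : Tendsto Nat.sqrt atTop atTop := tendsto_atTop.mpr fun b => by
    filter_upwards [eventually_ge_atTop (b * b)] with N hN
    exact Nat.le_sqrt.mpr hN
  refine squeeze_zero' (Eventually.of_forall fun N => by positivity) ?_
    (tendsto_primeCounting_div.comp hsqrt)
  filter_upwards [eventually_ge_atTop 1] with N hN
  have hs : (0 : ℝ) < N.sqrt := by exact_mod_cast Nat.sqrt_pos.mpr hN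
  have hN0 : (0 : ℝ) < N := by exact_mod_cast hN
  have h : (N.sqrt : ℝ) * N.sqrt ≤ N := by exact_mod_cast Nat.sqrt_le N
  simp only [Function.comp_apply]
  rw [div_le_div_iff₀ hN0 hs]
  push_cast
  rw [mul_assoc]
  exact mul_le_mul_of_nonneg_left h (Nat.cast_nonneg _)

theorem summable_log_div_sq : Summable fun q : ℕ => 24 * Real.log (q + 1) / (q : ℝ) ^ 2 := by
  have h : Summable fun q : ℕ => 96 * (1 / (q : ℝ) ^ (3 / 2 : ℝ)) :=
    (Real.summable_one_div_nat_rpow.mpr (by norm_num)).mul_left _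
  refine Summable.of_nonneg_of_le (fun q => ?_) (fun q => ?_) h
  · have : 0 ≤ Real.log ((q : ℝ) + 1) := Real.log_nonneg (by linarith [q.cast_nonneg (α := ℝ)])
    positivity
  rcases Nat.eq_zero_or_pos q with rfl | hq
  · simp
  have hq1 : (1 : ℝ) ≤ q := by exact_mod_cast hq
  have hq0 : (0 : ℝ) < q := by linarith
  -- `log x ≤ 2 √x` and the crude `q + 1 ≤ 4 q`, whose factor has a rational root; `24 * 4 = 96`.
  have h1 : Real.log ((q : ℝ) + 1) ≤ 4 * (q : ℝ) ^ (1 / 2 : ℝ) := by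
    have h2 := Real.log_le_rpow_div (x := (q : ℝ) + 1) (by linarith) (ε := 1 / 2) (by norm_num)
    have h3 : ((q : ℝ) + 1) ^ (1 / 2 : ℝ) ≤ (4 * q) ^ (1 / 2 : ℝ) :=
      Real.rpow_le_rpow (by linarith) (by linarith) (by norm_num)
    rw [Real.mul_rpow (by norm_num) hq0.le,
      show (4 : ℝ) ^ (1 / 2 : ℝ) = 2 by
        rw [← Real.sqrt_eq_rpow, show (4 : ℝ) = 2 ^ 2 by norm_num]
        exact Real.sqrt_sq (by norm_num)] at h3
    linarith
  have h4 : (q : ℝ) ^ 2 = (q : ℝ) ^ (3 / 2 : ℝ) * (q : ℝ) ^ (1 / 2 : ℝ) := by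
    rw [← Real.rpow_add hq0, ← Real.rpow_natCast]
    norm_num
  have h5 : 0 < (q : ℝ) ^ (1 / 2 : ℝ) := by positivity
  have h6 : 0 < (q : ℝ) ^ (3 / 2 : ℝ) := by positivity
  rw [h4, mul_one_div, div_le_div_iff₀ (by positivity) h6]
  nlinarith [mul_le_mul_of_nonneg_right h1 h6.le]

theorem multipliable_one_sub_inv_mul_sub_one :
    Multipliable (fun p : Nat.Primes => 1 - 1 / (((p : ℕ) : ℝ) * (((p : ℕ) : ℝ) - 1))) := by
  have hs : Summable fun p : Nat.Primes => -(1 / (((p : ℕ) : ℝ) * (((p : ℕ) : ℝ) - 1))) := by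
    refine Summable.neg ?_
    have h : Summable fun p : Nat.Primes => 2 * (1 / ((p : ℕ) : ℝ) ^ 2) :=
      ((Real.summable_one_div_nat_pow.mpr one_lt_two).mul_left 2).comp_injective
        Subtype.val_injective
    refine Summable.of_nonneg_of_le (fun p => ?_) (fun p => ?_) h
    · have : (2 : ℝ) ≤ (p : ℕ) := by exact_mod_cast p.2.two_le
      exact one_div_nonneg.mpr (mul_nonneg (by linarith) (by linarith))
    · have : (2 : ℝ) ≤ (p : ℕ) := by exact_mod_cast p.2.two_le
      rw [mul_one_div, div_le_div_iff₀ (by nlinarith) (by positivity)]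
      nlinarith
  simpa only [← sub_eq_add_neg] using Real.multipliable_one_add_of_summable hs

theorem tendsto_prod_primesLE {f : ℕ → ℝ} (hf : Multipliable fun p : Nat.Primes => f p) :
    Tendsto (fun z : ℕ => ∏ p ∈ Nat.primesLE z, f p) atTop (𝓝 (∏' p : Nat.Primes, f p)) := by
  have hmono : Tendsto (fun z : ℕ => (Nat.primesLE z).subtype Nat.Prime) atTop atTop := by
    refine tendsto_atTop_finset_of_monotone (fun a b hab p hp => ?_) fun p => ⟨p, ?_⟩
    · rw [mem_subtype, Nat.mem_primesLE] at hp ⊢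
      exact ⟨hp.1.trans hab, hp.2⟩
    · rw [mem_subtype, Nat.mem_primesLE]
      exact ⟨le_rfl, p.2⟩
  refine (hf.hasProd.comp hmono).congr fun z => ?_
  exact prod_subtype_of_mem f fun p hp => Nat.prime_of_mem_primesLE hp

theorem hasNaturalDensity_largeCoprimeSet : HasNaturalDensity largeCoprimeSet
    (Real.log 2 * ∏' p : Nat.Primes, (1 - 1 / (((p : ℕ) : ℝ) * (((p : ℕ) : ℝ) - 1)))) := by
  set L := Real.log 2 * ∏' p : Nat.Primes, (1 - 1 / (((p : ℕ) : ℝ) * (((p : ℕ) : ℝ) - 1)))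
  have hL : Tendsto (fun z : ℕ => Real.log 2 *
      ∏ p ∈ Nat.primesLE z, (1 - 1 / ((p : ℝ) * (p - 1)))) atTop (𝓝 L) :=
    (tendsto_prod_primesLE (f := fun p => 1 - 1 / ((p : ℝ) * (p - 1)))
      multipliable_one_sub_inv_mul_sub_one).const_mul _
  have hT := (tendsto_sum_nat_add fun q : ℕ => 24 * Real.log (q + 1) / (q : ℝ) ^ 2).comp
    (tendsto_add_atTop_nat 1)
  have hnn : ∀ q : ℕ, 0 ≤ 24 * Real.log (q + 1) / (q : ℝ) ^ 2 := fun q => by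
    have : 0 ≤ Real.log ((q : ℝ) + 1) := Real.log_nonneg (by linarith [q.cast_nonneg (α := ℝ)])
    positivity
  rw [HasNaturalDensity, Metric.tendsto_nhds]
  intro ε hε
  have hε4 : 0 < ε / 4 := by positivity
  -- `z` is fixed before `N`: the tail bound beyond `z` does not depend on `N`.
  obtain ⟨z, hz1, hz2⟩ := ((Metric.tendsto_nhds.mp hL _ hε4).and
    (hT.eventually (gt_mem_nhds hε4))).exists
  filter_upwards [Metric.tendsto_nhds.mp (tendsto_truncatedPairCount z) _ hε4,
    tendsto_primeCounting_sqrt_mul_sqrt_div.eventually (gt_mem_nhds hε4),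
    eventually_ge_atTop 2] with N h1 h2 hN
  have hN0 : (0 : ℝ) < N := by exact_mod_cast (by omega : 0 < N)
  have htail : ∑ q ∈ Ioc z N, 24 * Real.log (q + 1) / (q : ℝ) ^ 2 < ε / 4 := by
    refine lt_of_le_of_lt ?_ hz2
    have hs := (summable_nat_add_iff (z + 1)).mpr summable_log_div_sq
    have := hs.sum_le_tsum (range (N - z)) fun q _ => hnn _
    refine le_trans (le_of_eq ?_) this
    have hI : Ioc z N = Ico (z + 1) (N + 1) := by
      ext q
      rw [mem_Ioc, mem_Ico]
      omega
    rw [hI, sum_Ico_eq_sum_range, Nat.add_sub_add_right]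
    exact sum_congr rfl fun q _ => by rw [add_comm (z + 1) q]
  have b1 : (pairCount N : ℝ) / N ≤ (truncatedPairCount z N : ℝ) / N := by
    gcongr
    exact pairCount_le_truncatedPairCount z N
  have b2 : (truncatedPairCount z N : ℝ) / N ≤ (pairCount N : ℝ) / N +
      ∑ q ∈ Ioc z N, 24 * Real.log (q + 1) / (q : ℝ) ^ 2 := by
    rw [div_le_iff₀ hN0, add_mul, div_mul_cancel₀ _ hN0.ne', mul_comm _ (N : ℝ)]
    exact truncatedPairCount_le hN
  have b3 : (pairCount N : ℝ) / N ≤ ((largeCoprimeSet ∩ Set.Icc 1 N).ncard : ℝ) / N := by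
    gcongr
    exact pairCount_le_ncard N
  have b4 : ((largeCoprimeSet ∩ Set.Icc 1 N).ncard : ℝ) / N ≤ (pairCount N : ℝ) / N +
      ((Nat.primeCounting N.sqrt * N.sqrt : ℕ) : ℝ) / N := by
    rw [← add_div]
    gcongr
    exact_mod_cast ncard_le_pairCount_add N
  rw [Real.dist_eq, abs_lt] at *
  constructor <;> linarith [hz1.1, hz1.2, h1.1, h1.2]

end Density

/-- The positive integers `n` whose largest prime factor `p` satisfies `p > √n` and
`gcd(p - 1, n) = 1` have natural density `log 2 * ∏ (1 - 1 / (p (p - 1)))`, where the infinite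
product over all primes converges. -/
theorem proposition2 :
    Multipliable (fun p : Nat.Primes => 1 - 1 / (((p : ℕ) : ℝ) * (((p : ℕ) : ℝ) - 1))) ∧
    HasNaturalDensity
      {n : ℕ | ∃ p : ℕ, IsLargestPrimeFactor p n ∧ Real.sqrt (n : ℝ) < (p : ℝ) ∧
        Nat.gcd (p - 1) n = 1}
      (Real.log 2 *
        ∏' p : Nat.Primes, (1 - 1 / (((p : ℕ) : ℝ) * (((p : ℕ) : ℝ) - 1)))) :=
  ⟨multipliable_one_sub_inv_mul_sub_one, hasNaturalDensity_largeCoprimeSet⟩
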